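/- Let $X_1,X_2,\dots$ be real random variables such that, for every $n$, each of the $n!$ strict orderings of $X_1,\dots,X_n$ has probability $1/n!$ (for instance i.i.d. random variables with a continuous distribution). Let $R_i^n=\#\{j\le n: X_j\le X_i\}$ be the rank of $X_i$ among $X_1,\dots,X_n$. Fix $0<p\le 1$. The $p$-percentile rule retains $X_1$ and, for $n\ge 2$, retains $X_n$ if and only if $R_n^n\le\lceil pL_{n-1}\rceil$, where $L_n$ is the number of items retained among the first $n$. Let $S_n\subseteq\{1,\dots,n\}$ be the set of indices of the items retained after $n$ observations, $Q_n=\sum_{i\in S_n}R_i^n$, and let $A_n=Q_n/L_n$ be the average rank of the retained items. Theorem 5.1. There exist constants $0<c_p<\infty$ and $0<b_p<\infty$, depending only on $p$ (and not on the sequence $(X_n)$), such that $L_n$ and $A_n$ are integrable for every $n\ge 1$ and, as $n\to\infty$, $$\frac{E(L_n)}{n^p}\to c_p,\qquad \frac{E(A_n)}{a_n(p)}\to b_p,\qquad\text{where}\quad a_n(p)=\begin{cases} n^{1-p}, & p<1/2,\\ n^{1/2}\log n, & p=1/2,\\ n^{p}, & p>1/2.\end{cases}$$ Moreover $b_{1/2}=c_{1/2}/8$,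 and $b_p=\dfrac{p^2}{2(2p-1)}\,c_p$ for $1/2<p\le 1$. -/

import Mathlib

open MeasureTheory ProbabilityTheory Filter Topology

namespace RankSelection

/-! Observations are indexed from zero: `x k` is the observation made at time `k + 1`, and the first
`n` observations are `x 0, …, x (n - 1)`. Smaller values are better. -/

/-- The rank of the observation `x i` among the first `n` observations: the number of `j < n` with
`x j ≤ x i`. -/
noncomputable def rank (x : ℕ → ℝ) (n i : ℕ) : ℕ :=
  ((Finset.range n).filter (fun j => x j ≤ x i)).card

/-- The set of indices retained among the first `n` observations by the selection rule with
threshold function `r`: a new observation is retained if and only if its rank among all the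
observations made so far, itself included, is at most `r` of the number of items already kept. -/
noncomputable def retained (r : ℕ → ℕ) (x : ℕ → ℝ) : ℕ → Finset ℕ
  | 0 => ∅
  | n + 1 =>
    if rank x (n + 1) n ≤ r (retained r x n).card then insert n (retained r x n)
    else retained r x n

/-- The threshold function of the `p`-percentile rule: `r 0 = 1` (the first observation is always
kept) and `r k = ⌈p * k⌉` for `k ≥ 1`. -/
noncomputable def percentileThreshold (p : ℝ) (k : ℕ) : ℕ :=
  if k = 0 then 1 else ⌈p * (k : ℝ)⌉₊

/-- `L_n`, the number of items retained by the `p`-percentile rule after `n` observations. -/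
noncomputable def numRetained (p : ℝ) (x : ℕ → ℝ) (n : ℕ) : ℕ :=
  (retained (percentileThreshold p) x n).card

/-- `Q_n`, the sum of the ranks, among the first `n` observations, of the items retained by the
`p`-percentile rule after `n` observations. -/
noncomputable def rankSum (p : ℝ) (x : ℕ → ℝ) (n : ℕ) : ℕ :=
  ∑ i ∈ retained (percentileThreshold p) x n, rank x n i

/-- `A_n = Q_n / L_n`, the average rank of the retained items. For `n ≥ 1` the denominator is
positive, because the first observation is always retained. -/
noncomputable def avgRank (p : ℝ) (x : ℕ → ℝ) (n : ℕ) : ℝ :=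
  (rankSum p x n : ℝ) / (numRetained p x n : ℝ)

/-- The normalizer `a_n(p)`. -/
noncomputable def normalizer (p : ℝ) (n : ℕ) : ℝ :=
  if p < 1 / 2 then (n : ℝ) ^ (1 - p)
  else if p = 1 / 2 then (n : ℝ) ^ (1 / 2 : ℝ) * Real.log (n : ℝ)
  else (n : ℝ) ^ p

/-- For every `n`, each of the `n!` strict orderings of the first `n` observations has
probability `1 / n!` (in particular there are almost surely no ties). -/
def OrderingsEquallyLikely {Ω : Type*} [MeasurableSpace Ω] (μ : Measure Ω) (X : ℕ → Ω → ℝ) : Prop :=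
  ∀ (n : ℕ) (σ : Equiv.Perm (Fin n)),
    μ {ω | StrictMono (fun i : Fin n => X (σ i : ℕ) ω)} = ((n.factorial : ℕ) : ENNReal)⁻¹

/-- Independent, identically distributed observations with a continuous (atomless) distribution
satisfy `OrderingsEquallyLikely`. -/
theorem orderingsEquallyLikely_of_iid {Ω : Type*} [MeasurableSpace Ω] (μ : Measure Ω)
    [IsProbabilityMeasure μ] (X : ℕ → Ω → ℝ) (hX : ∀ n, Measurable (X n)) (hind : iIndepFun X μ)
    (hid : ∀ n, μ.map (X n) = μ.map (X 0)) (hc : ∀ a : ℝ, μ {ω | X 0 ω = a} = 0) :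
    OrderingsEquallyLikely μ X := by
  intro n σ
  have : IsProbabilityMeasure (μ.map (X 0)) := Measure.isProbabilityMeasure_map (hX 0).aemeasurable
  have hc' : ∀ a : ℝ, μ.map (X 0) {a} = 0 := fun a => by
    rw [Measure.map_apply (hX 0) (measurableSet_singleton a)]
    exact hc a
  have hlaw : ∀ τ : Equiv.Perm (Fin n),
      μ.map (fun ω (i : Fin n) => X (τ i : ℕ) ω) = Measure.pi (fun _ => μ.map (X 0)) := by
    intro τ
    have h1 : iIndepFun (fun i : Fin n => X (τ i : ℕ)) μ :=
      hind.precomp (g := fun i : Fin n => (τ i : ℕ)) (Fin.val_injective.comp τ.injective)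
    rw [(iIndepFun_iff_map_fun_eq_pi_map (fun i => (hX _).aemeasurable)).1 h1]
    congr 1
    funext i
    exact hid _
  have hS : MeasurableSet {v : Fin n → ℝ | StrictMono v} := by
    have : {v : Fin n → ℝ | StrictMono v}
        = ⋂ (i : Fin n) (j : Fin n) (_ : i < j), {v | v i < v j} := by
      ext v
      simp [StrictMono]
    rw [this]
    exact MeasurableSet.iInter fun i => MeasurableSet.iInter fun j => MeasurableSet.iInter fun _ =>
      measurableSet_lt (measurable_pi_apply i) (measurable_pi_apply j)
  have hm : ∀ τ : Equiv.Perm (Fin n), Measurable (fun ω (i : Fin n) => X (τ i : ℕ) ω) :=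
    fun τ => measurable_pi_lambda _ (fun i => hX _)
  have heq : ∀ τ : Equiv.Perm (Fin n), μ {ω | StrictMono (fun i : Fin n => X (τ i : ℕ) ω)}
      = Measure.pi (fun _ : Fin n => μ.map (X 0)) {v | StrictMono v} := by
    intro τ
    rw [← hlaw τ, Measure.map_apply (hm τ) hS]
    rfl
  have hne : ∀ i j : ℕ, i ≠ j → ∀ᵐ ω ∂μ, X i ω ≠ X j ω := by
    intro i j hij
    have h2 := (hind.indepFun hij).map_prod_eq_prod_map_map (hX i).aemeasurable
      (hX j).aemeasurable
    rw [hid i, hid j] at h2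
    have hD : MeasurableSet {q : ℝ × ℝ | q.1 = q.2} :=
      measurableSet_eq_fun measurable_fst measurable_snd
    have h3 : (μ.map (X 0)).prod (μ.map (X 0)) {q : ℝ × ℝ | q.1 = q.2} = 0 := by
      rw [Measure.measure_prod_null hD]
      refine Eventually.of_forall fun a => ?_
      have : Prod.mk a ⁻¹' {q : ℝ × ℝ | q.1 = q.2} = {a} := by
        ext b
        simp [eq_comm]
      simp [this, hc' a]
    rw [← h2, Measure.map_apply ((hX i).prodMk (hX j)) hD] at h3
    rw [ae_iff]
    simpa using h3
  have hinj : ∀ᵐ ω ∂μ, ∀ i j : ℕ, i ≠ j → X i ω ≠ X j ω := by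
    rw [ae_all_iff]
    intro i
    rw [ae_all_iff]
    intro j
    by_cases h : i = j
    · simp [h]
    · simpa [h] using hne i j h
  have hU : μ (⋃ τ : Equiv.Perm (Fin n), {ω | StrictMono (fun i : Fin n => X (τ i : ℕ) ω)}) = 1 := by
    rw [← measure_univ (μ := μ)]
    refine measure_congr ?_
    filter_upwards [hinj] with ω hω
    refine propext ⟨fun _ => trivial, fun _ => ?_⟩
    refine Set.mem_iUnion.2 ⟨Tuple.sort (fun i : Fin n => X (i : ℕ) ω), ?_⟩
    refine (Tuple.monotone_sort (fun i : Fin n => X (i : ℕ) ω)).strictMono_of_injective ?_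
    refine Function.Injective.comp (fun i j hij => ?_) (Equiv.injective _)
    by_contra hne'
    exact hω i j (fun h => hne' (Fin.ext h)) hij
  rw [measure_iUnion] at hU
  · simp only [heq] at hU ⊢
    rw [tsum_fintype, Finset.sum_const, Finset.card_univ, Fintype.card_perm, Fintype.card_fin,
      nsmul_eq_mul, mul_comm] at hU
    exact ENNReal.eq_inv_of_mul_eq_one_left hU
  · intro τ τ' hne'
    refine Set.disjoint_left.2 fun ω h1 h2 => hne' ?_
    have e1 := (Tuple.unique_monotone (f := fun i : Fin n => X (i : ℕ) ω) (σ := τ) (τ := τ')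
      (StrictMono.monotone h1) (StrictMono.monotone h2))
    ext i
    have e2 := congrFun e1 i
    have hin : Function.Injective (fun i : Fin n => X (i : ℕ) ω) := by
      have := (StrictMono.injective h1)
      have h4 : (fun i : Fin n => X (i : ℕ) ω) = (fun i : Fin n => X (τ i : ℕ) ω) ∘ τ.symm := by
        funext k
        simp
      rw [h4]
      exact this.comp τ.symm.injective
    exact congrArg Fin.val (hin e2)
  · exact fun τ => hm τ hS

end RankSelection

/-! In the absence of ties, the set T of retained ranks evolves as a Markov chain: the newcomer's
rank among the first n + 1 observations is uniform on 1, …, n + 1, and it determines the next T.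
Expectations thus become `rankMean`, an iterated finite average in which neither the probability
space nor the sequence appears; this is why the constants depend on p alone.

Write L = |T|, Q for the sum of T, A = Q / L and m = ⌈pL⌉. For n ≥ 1, averaging over the newcomer
gives (n+1) E L_{n+1} = (n+1) E L_n + E m (`rankMean_card_succ`). Up to a bounded error this is the
recursion solved by `rising p n` = ∏ (1 + p/k), which is asymptotic to n^p / Γ(p+1). Similarly,
(n+1) E A_{n+1} = (n+1+(1-p)) E A_n + (p²/2) E L_n + error (`rankMean_avgElem_succ`), with error at
most E[Q/(L(L+1))] + 3.

The error is controlled through W = Q/(L(L-1)), whose own recursion has exponent at most 1 - 4p/3,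
so it is o(n^max(p, 1-p)). After division by `rising (1 - p)`, the increments of E A_n are driven by
a term of order n^(2p-2). The series is summable for p < 1/2, harmonic for p = 1/2 and of order
n^(2p-1) for p > 1/2. In the last two cases the Stolz-Cesàro theorem gives the constant. In the
first, the limit is shown to be positive by means of the submultiplicative lower bound Q/(L + 2/p).
-/

namespace RankSelection

/-! ### Dynamics of the set of retained ranks -/

/-- The set of ranks, among the first `n` observations, of the items retained so far. -/
noncomputable def retainedRanks (p : ℝ) (x : ℕ → ℝ) (n : ℕ) : Finset ℕ :=
  (retained (percentileThreshold p) x n).image (rank x n)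

/-- The new rank of an item of rank `t` after the arrival of an observation of rank `r`. -/
def shiftRank (r t : ℕ) : ℕ := if r ≤ t then t + 1 else t

/-- The set of retained ranks after the arrival of an observation of rank `r`. -/
noncomputable def insertRank (p : ℝ) (T : Finset ℕ) (r : ℕ) : Finset ℕ :=
  if r ≤ percentileThreshold p T.card then insert r (T.image (shiftRank r))
  else T.image (shiftRank r)

theorem shiftRank_injective (r : ℕ) : Function.Injective (shiftRank r) := by
  intro a b h
  unfold shiftRank at h
  split_ifs at h <;> omega

theorem shiftRank_ne (r t : ℕ) : shiftRank r t ≠ r := by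
  unfold shiftRank
  split_ifs <;> omega

theorem notMem_image_shiftRank (r : ℕ) (T : Finset ℕ) : r ∉ T.image (shiftRank r) := by
  simp [shiftRank_ne]

theorem card_insertRank (p : ℝ) (T : Finset ℕ) (r : ℕ) :
    (insertRank p T r).card
      = if r ≤ percentileThreshold p T.card then T.card + 1 else T.card := by
  unfold insertRank
  split_ifs
  · rw [Finset.card_insert_of_notMem (notMem_image_shiftRank r T),
      Finset.card_image_of_injective _ (shiftRank_injective r)]
  · rw [Finset.card_image_of_injective _ (shiftRank_injective r)]

theorem sum_image_shiftRank (T : Finset ℕ) (r : ℕ) :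
    ∑ t ∈ T.image (shiftRank r), t = ∑ t ∈ T, t + (T.filter (fun t => r ≤ t)).card := by
  rw [Finset.sum_image (fun a _ b _ h => shiftRank_injective r h), Finset.card_filter,
    ← Finset.sum_add_distrib]
  refine Finset.sum_congr rfl fun t _ => ?_
  unfold shiftRank
  split_ifs <;> rfl

theorem sum_insertRank (p : ℝ) (T : Finset ℕ) (r : ℕ) :
    ∑ t ∈ insertRank p T r, t = ∑ t ∈ T, t + (T.filter (fun t => r ≤ t)).card
      + if r ≤ percentileThreshold p T.card then r else 0 := by
  unfold insertRank
  split_ifs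
  · rw [Finset.sum_insert (notMem_image_shiftRank r T), sum_image_shiftRank, add_comm]
  · rw [sum_image_shiftRank, add_zero]

theorem rank_succ (x : ℕ → ℝ) (n i : ℕ) :
    rank x (n + 1) i = rank x n i + if x n ≤ x i then 1 else 0 := by
  unfold rank
  rw [Finset.card_filter, Finset.card_filter, Finset.sum_range_succ]

theorem rank_lt_rank {x : ℕ → ℝ} {n i j : ℕ} (hj : j < n) (h : x i < x j) :
    rank x n i < rank x n j := by
  unfold rank
  refine Finset.card_lt_card ?_
  rw [Finset.ssubset_iff_of_subset]
  · exact ⟨j, by simp [hj], by simp [h]⟩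
  · intro k hk
    simp only [Finset.mem_filter] at hk ⊢
    exact ⟨hk.1, hk.2.trans h.le⟩

theorem rank_injOn {x : ℕ → ℝ} {n : ℕ} (hx : Set.InjOn x (Set.Iio n)) :
    Set.InjOn (rank x n) (Set.Iio n) := by
  intro i hi j hj h
  rcases lt_trichotomy (x i) (x j) with h1 | h1 | h1
  · exact absurd h (rank_lt_rank hj h1).ne
  · exact hx hi hj h1
  · exact absurd h (rank_lt_rank hi h1).ne'

/-- This lets the dynamics be read on ranks alone. The newcomer's rank is one more than the number
of old observations below it, while an old item's rank among the old ones already counts itself. -/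
theorem le_iff_rank_le {x : ℕ → ℝ} {n i : ℕ} (hx : Set.InjOn x (Set.Iio (n + 1))) (hi : i < n) :
    x n ≤ x i ↔ rank x (n + 1) n ≤ rank x n i := by
  have hne : x n ≠ x i := fun h => by
    have := hx (Set.mem_Iio.2 (Nat.lt_succ_self n)) (Set.mem_Iio.2 (hi.trans (Nat.lt_succ_self n))) h
    omega
  have hle : ∀ a b, x a ≤ x b → rank x n a ≤ rank x n b := fun a b h =>
    Finset.card_le_card fun k hk => by
      simp only [Finset.mem_filter] at hk ⊢
      exact ⟨hk.1, hk.2.trans h⟩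
  rw [rank_succ, if_pos le_rfl]
  constructor
  · intro h
    exact rank_lt_rank hi (lt_of_le_of_ne h hne)
  · intro h
    by_contra h'
    have := hle i n (not_le.1 h').le
    omega

theorem retained_subset (r : ℕ → ℕ) (x : ℕ → ℝ) (n : ℕ) : retained r x n ⊆ Finset.range n := by
  induction n with
  | zero => simp [retained]
  | succ n ih =>
    have h : Finset.range n ⊆ Finset.range (n + 1) := Finset.range_mono (Nat.le_succ n)
    unfold retained
    split_ifs
    · exact Finset.insert_subset (by simp) (ih.trans h)
    · exact ih.trans h

theorem rank_injOn_retained {x : ℕ → ℝ} {n : ℕ} (r : ℕ → ℕ) (hx : Set.InjOn x (Set.Iio n)) :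
    Set.InjOn (rank x n) (retained r x n) :=
  (rank_injOn hx).mono fun _ hi => Finset.mem_range.1 (retained_subset r x n hi)

theorem card_retainedRanks (p : ℝ) {x : ℕ → ℝ} {n : ℕ} (hx : Set.InjOn x (Set.Iio n)) :
    (retainedRanks p x n).card = numRetained p x n :=
  Finset.card_image_of_injOn (rank_injOn_retained _ hx)

theorem sum_retainedRanks (p : ℝ) {x : ℕ → ℝ} {n : ℕ} (hx : Set.InjOn x (Set.Iio n)) :
    ∑ t ∈ retainedRanks p x n, t = rankSum p x n :=
  Finset.sum_image (rank_injOn_retained _ hx)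

theorem retainedRanks_succ (p : ℝ) {x : ℕ → ℝ} {n : ℕ} (hx : Set.InjOn x (Set.Iio (n + 1))) :
    retainedRanks p x (n + 1) = insertRank p (retainedRanks p x n) (rank x (n + 1) n) := by
  have hx' : Set.InjOn x (Set.Iio n) := hx.mono (Set.Iio_subset_Iio (Nat.le_succ n))
  have hold : (retained (percentileThreshold p) x n).image (rank x (n + 1))
      = (retainedRanks p x n).image (shiftRank (rank x (n + 1) n)) := by
    rw [retainedRanks, Finset.image_image]
    refine Finset.image_congr fun i hi => ?_
    have hi' := Finset.mem_range.1 (retained_subset _ x n hi)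
    simp only [Function.comp, shiftRank, ← le_iff_rank_le hx hi']
    rw [rank_succ]
    split_ifs <;> rfl
  rw [insertRank, card_retainedRanks p hx', ← hold, retainedRanks, retained, numRetained]
  split_ifs
  · rw [Finset.image_insert]
  · rfl

/-! ### Averages over orderings, and their identification with expectations -/

/-- The average of a function of the set of retained ranks over the `n + 1` possible ranks of the
next observation. -/
noncomputable def stepMean (p : ℝ) (n : ℕ) : (Finset ℕ → ℝ) →ₗ[ℝ] (Finset ℕ → ℝ) where
  toFun g T := (∑ r ∈ Finset.Icc 1 (n + 1), g (insertRank p T r)) / (n + 1 : ℝ)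
  map_add' g h := by
    funext T
    simp [Finset.sum_add_distrib, add_div]
  map_smul' a g := by
    funext T
    simp [← Finset.mul_sum, mul_div_assoc]

/-- The expectation of a function of the set of retained ranks after `n` observations, when each
new relative rank is uniform and independent of the past. -/
noncomputable def rankMean (p : ℝ) : ℕ → (Finset ℕ → ℝ) →ₗ[ℝ] ℝ
  | 0 => LinearMap.proj ∅
  | n + 1 => (rankMean p n).comp (stepMean p n)

theorem rankMean_zero (p : ℝ) (g : Finset ℕ → ℝ) : rankMean p 0 g = g ∅ := rfl

theorem rankMean_succ (p : ℝ) (n : ℕ) (g : Finset ℕ → ℝ) : rankMean p (n + 1) g = rankMean p n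
    (fun T => (∑ r ∈ Finset.Icc 1 (n + 1), g (insertRank p T r)) / (n + 1 : ℝ)) := rfl

/-- The orderings of `n + 1` observations correspond to the position of the last observation and
the ordering of the first `n` ones. -/
noncomputable def permSuccEquiv (n : ℕ) : Fin (n + 1) × Equiv.Perm (Fin n) ≃ Equiv.Perm (Fin (n + 1)) :=
  Equiv.ofBijective
    (fun a => ((finSuccEquiv' a.1).trans (Equiv.optionCongr a.2)).trans
      (finSuccEquiv' (Fin.last n)).symm) (by
    rw [Fintype.bijective_iff_injective_and_card]
    constructor
    · rintro ⟨r, σ⟩ ⟨r', σ'⟩ h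
      have h1 : ∀ i, ((finSuccEquiv' (Fin.last n)).symm ((Equiv.optionCongr σ) (finSuccEquiv' r i)))
          = ((finSuccEquiv' (Fin.last n)).symm ((Equiv.optionCongr σ') (finSuccEquiv' r' i))) :=
        fun i => DFunLike.congr_fun h i
      have h2 : ∀ i, (Equiv.optionCongr σ) (finSuccEquiv' r i)
          = (Equiv.optionCongr σ') (finSuccEquiv' r' i) := fun i => Equiv.injective _ (h1 i)
      -- The position r is the only index sent to `none`, so the permutation determines it.
      have hr : r = r' := by
        have h3 := h2 r
        simp only [finSuccEquiv'_at, Equiv.optionCongr_apply, Option.map_none] at h3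
        have h4 : finSuccEquiv' r' r = none := by
          rcases h5 : finSuccEquiv' r' r with _ | a
          · rfl
          · simp [h5] at h3
        rw [← finSuccEquiv'_at r'] at h4
        exact (Equiv.injective _ h4)
      subst hr
      refine Prod.ext rfl (Equiv.ext fun i => ?_)
      have h3 := h2 (r.succAbove i)
      simpa using h3
    · simp [Fintype.card_perm, Nat.factorial_succ])

theorem permSuccEquiv_self {n : ℕ} (r : Fin (n + 1)) (σ : Equiv.Perm (Fin n)) :
    permSuccEquiv n (r, σ) r = Fin.last n := by
  simp [permSuccEquiv]

theorem permSuccEquiv_succAbove {n : ℕ} (r : Fin (n + 1)) (σ : Equiv.Perm (Fin n)) (i : Fin n) :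
    permSuccEquiv n (r, σ) (r.succAbove i) = (σ i).castSucc := by
  simp [permSuccEquiv]

theorem injOn_of_strictMono {x : ℕ → ℝ} {n : ℕ} {σ : Equiv.Perm (Fin n)}
    (h : StrictMono fun i : Fin n => x (σ i : ℕ)) : Set.InjOn x (Set.Iio n) := by
  intro i hi j hj hij
  have h1 : σ.symm ⟨i, hi⟩ = σ.symm ⟨j, hj⟩ := h.injective (by simpa using hij)
  exact congrArg Fin.val (σ.symm.injective h1)

theorem strictMono_of_permSuccEquiv {x : ℕ → ℝ} {n : ℕ} {r : Fin (n + 1)} {σ : Equiv.Perm (Fin n)}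
    (h : StrictMono fun i : Fin (n + 1) => x (permSuccEquiv n (r, σ) i : ℕ)) :
    StrictMono fun i : Fin n => x (σ i : ℕ) := by
  have := h.comp (Fin.strictMono_succAbove r)
  simpa [Function.comp_def, permSuccEquiv_succAbove] using this

theorem rank_of_permSuccEquiv {x : ℕ → ℝ} {n : ℕ} {r : Fin (n + 1)} {σ : Equiv.Perm (Fin n)}
    (h : StrictMono fun i : Fin (n + 1) => x (permSuccEquiv n (r, σ) i : ℕ)) :
    rank x (n + 1) n = r + 1 := by
  set τ := permSuccEquiv n (r, σ) with hτ
  have hr : ((τ r : Fin (n + 1)) : ℕ) = n := by rw [hτ, permSuccEquiv_self]; rfl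
  have h1 : (Finset.range (n + 1)).filter (fun j => x j ≤ x n)
      = (Finset.Iic r).map (τ.toEmbedding.trans Fin.valEmbedding) := by
    ext j
    simp only [Finset.mem_filter, Finset.mem_range, Finset.mem_map, Finset.mem_Iic,
      Function.Embedding.trans_apply, Equiv.coe_toEmbedding, Fin.valEmbedding_apply]
    constructor
    · rintro ⟨hj, hle⟩
      refine ⟨τ.symm ⟨j, hj⟩, ?_, by simp⟩
      rw [← h.le_iff_le]
      simpa [hr] using hle
    · rintro ⟨a, ha, rfl⟩
      refine ⟨(τ a).2, ?_⟩
      have := h.le_iff_le.2 ha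
      simpa [hr] using this
  rw [rank, h1, Finset.card_map, Fin.card_Iic]

/-- On the event that the first `n` observations are ordered by `σ`, the set of retained ranks is a
function of `σ`, and averaging over all orderings gives `rankMean`. -/
theorem exists_retainedRanks_perm (p : ℝ) (n : ℕ) :
    ∃ t : Equiv.Perm (Fin n) → Finset ℕ,
      (∀ (x : ℕ → ℝ) (σ : Equiv.Perm (Fin n)),
        StrictMono (fun i : Fin n => x (σ i : ℕ)) → retainedRanks p x n = t σ) ∧
      ∀ g : Finset ℕ → ℝ, (∑ σ, g (t σ)) / (n.factorial : ℝ) = rankMean p n g := by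
  induction n with
  | zero =>
    refine ⟨fun _ => ∅, fun x σ _ => by simp [retainedRanks, retained], fun g => ?_⟩
    simp [rankMean_zero]
  | succ n ih =>
    obtain ⟨t, ht, hm⟩ := ih
    -- The permutation lists the observations in increasing order; positions start at 0 and ranks at
    -- 1, hence the `+ 1`.
    refine ⟨fun τ => insertRank p (t ((permSuccEquiv n).symm τ).2)
      (((permSuccEquiv n).symm τ).1 + 1), fun x τ hτ => ?_, fun g => ?_⟩
    · obtain ⟨⟨r, σ⟩, rfl⟩ := (permSuccEquiv n).surjective τ
      rw [retainedRanks_succ p (injOn_of_strictMono hτ), rank_of_permSuccEquiv hτ,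
        ht x σ (strictMono_of_permSuccEquiv hτ)]
      simp
    · rw [rankMean_succ, ← hm, ← (permSuccEquiv n).sum_comp, Fintype.sum_prod_type,
        Finset.sum_comm, Finset.sum_div, Finset.sum_div]
      refine Finset.sum_congr rfl fun σ _ => ?_
      simp only [Equiv.symm_apply_apply]
      rw [Fin.sum_univ_eq_sum_range (fun r => g (insertRank p (t σ) (r + 1))) (n + 1),
        Finset.range_eq_Ico, Finset.sum_Ico_add' (fun r => g (insertRank p (t σ) r)) 0 (n + 1) 1,
        div_div, Nat.factorial_succ]
      push_cast
      rfl

/-- The n! ordering events are disjoint and of mass 1/n!, so they cover almost every ω, and F is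
almost everywhere a simple function. No measurability of F has to be known beforehand. -/
theorem integral_eq_sum_perm {Ω : Type*} [MeasurableSpace Ω] {μ : Measure Ω}
    [IsProbabilityMeasure μ] {X : ℕ → Ω → ℝ} (hX : ∀ k, Measurable (X k))
    (hμ : OrderingsEquallyLikely μ X) {n : ℕ} {F : Ω → ℝ} {c : Equiv.Perm (Fin n) → ℝ}
    (hF : ∀ σ ω, StrictMono (fun i : Fin n => X (σ i : ℕ) ω) → F ω = c σ) :
    Integrable F μ ∧ ∫ ω, F ω ∂μ = (∑ σ, c σ) / (n.factorial : ℝ) := by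
  set O : Equiv.Perm (Fin n) → Set Ω := fun σ => {ω | StrictMono fun i : Fin n => X (σ i : ℕ) ω}
    with hO
  have hmeas : ∀ σ, MeasurableSet (O σ) := by
    intro σ
    have : O σ = ⋂ (i : Fin n) (j : Fin n) (_ : i < j), {ω | X (σ i : ℕ) ω < X (σ j : ℕ) ω} := by
      ext ω
      simp [hO, StrictMono]
    rw [this]
    exact MeasurableSet.iInter fun i => MeasurableSet.iInter fun j => MeasurableSet.iInter fun _ =>
      measurableSet_lt (hX _) (hX _)
  have hdisj : Pairwise (Function.onFun Disjoint O) := by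
    intro σ τ hne
    refine Set.disjoint_left.2 fun ω h1 h2 => hne ?_
    have h1' : StrictMono fun i : Fin n => X (σ i : ℕ) ω := h1
    have h2' : StrictMono fun i : Fin n => X (τ i : ℕ) ω := h2
    have e := Tuple.unique_monotone (f := fun i : Fin n => X (i : ℕ) ω) (σ := σ) (τ := τ)
      h1'.monotone h2'.monotone
    ext i
    have e2 := congrFun e i
    exact congrArg Fin.val (Fin.ext (injOn_of_strictMono (x := fun k => X k ω) h1' (σ i).2 (τ i).2 e2))
  have hfac : (n.factorial : ENNReal) ≠ 0 := by simp [Nat.factorial_ne_zero]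
  have hunion : μ (⋃ σ, O σ) = 1 := by
    rw [measure_iUnion hdisj hmeas, tsum_fintype]
    simp only [hO, hμ n]
    rw [Finset.sum_const, Finset.card_univ, Fintype.card_perm, Fintype.card_fin, nsmul_eq_mul]
    exact ENNReal.mul_inv_cancel hfac (ENNReal.natCast_ne_top _)
  have hae : ∀ᵐ ω ∂μ, ω ∈ ⋃ σ, O σ := by
    exact (mem_ae_iff_prob_eq_one (MeasurableSet.iUnion hmeas)).2 hunion
  have hFae : F =ᵐ[μ] fun ω => ∑ σ, (O σ).indicator (fun _ => c σ) ω := by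
    filter_upwards [hae] with ω hω
    obtain ⟨σ, hσ⟩ := Set.mem_iUnion.1 hω
    rw [Finset.sum_eq_single σ, Set.indicator_of_mem hσ, hF σ ω hσ]
    · intro τ _ hne
      exact Set.indicator_of_notMem (fun h => Set.disjoint_left.1 (hdisj hne) h hσ) _
    · simp
  have hint : ∀ σ, Integrable ((O σ).indicator (fun _ => c σ)) μ := fun σ =>
    (integrable_const (c σ)).indicator (hmeas σ)
  refine ⟨(integrable_finsetSum _ fun σ _ => hint σ).congr hFae.symm, ?_⟩
  rw [integral_congr_ae hFae, integral_finsetSum _ fun σ _ => hint σ, Finset.sum_div]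
  refine Finset.sum_congr rfl fun σ _ => ?_
  rw [integral_indicator_const _ (hmeas σ), measureReal_def, hO, hμ n σ]
  simp [div_eq_inv_mul]

/-- The average of the elements of a finite set of natural numbers. -/
noncomputable def avgElem (T : Finset ℕ) : ℝ := (∑ t ∈ T, (t : ℝ)) / T.card

theorem integral_numRetained {Ω : Type*} [MeasurableSpace Ω] {μ : Measure Ω}
    [IsProbabilityMeasure μ] {X : ℕ → Ω → ℝ} (hX : ∀ k, Measurable (X k))
    (hμ : OrderingsEquallyLikely μ X) (p : ℝ) (n : ℕ) :
    Integrable (fun ω => (numRetained p (fun k => X k ω) n : ℝ)) μ ∧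
      ∫ ω, (numRetained p (fun k => X k ω) n : ℝ) ∂μ = rankMean p n (fun T => (T.card : ℝ)) := by
  obtain ⟨t, ht, hm⟩ := exists_retainedRanks_perm p n
  rw [← hm]
  refine integral_eq_sum_perm hX hμ fun σ ω h => ?_
  have hx := injOn_of_strictMono (x := fun k => X k ω) h
  rw [← ht (fun k => X k ω) σ h, card_retainedRanks p hx]

theorem integral_avgRank {Ω : Type*} [MeasurableSpace Ω] {μ : Measure Ω}
    [IsProbabilityMeasure μ] {X : ℕ → Ω → ℝ} (hX : ∀ k, Measurable (X k))
    (hμ : OrderingsEquallyLikely μ X) (p : ℝ) (n : ℕ) :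
    Integrable (fun ω => avgRank p (fun k => X k ω) n) μ ∧
      ∫ ω, avgRank p (fun k => X k ω) n ∂μ = rankMean p n avgElem := by
  obtain ⟨t, ht, hm⟩ := exists_retainedRanks_perm p n
  rw [← hm]
  refine integral_eq_sum_perm hX hμ fun σ ω h => ?_
  have hx := injOn_of_strictMono (x := fun k => X k ω) h
  rw [← ht (fun k => X k ω) σ h, avgElem, card_retainedRanks p hx, avgRank, ← sum_retainedRanks p hx]
  push_cast
  rfl

/-! ### Bounds on the threshold, and reachable sets of ranks -/

section Threshold

variable {p : ℝ} {k : ℕ}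

theorem le_percentileThreshold (hk : 1 ≤ k) : p * k ≤ percentileThreshold p k := by
  rw [percentileThreshold, if_neg (by omega)]
  exact Nat.le_ceil _

theorem percentileThreshold_lt (hp : 0 < p) (hk : 1 ≤ k) :
    (percentileThreshold p k : ℝ) < p * k + 1 := by
  rw [percentileThreshold, if_neg (by omega)]
  exact Nat.ceil_lt_add_one (by positivity)

theorem percentileThreshold_le (hp1 : p ≤ 1) (hk : 1 ≤ k) : percentileThreshold p k ≤ k := by
  rw [percentileThreshold, if_neg (by omega)]
  refine Nat.ceil_le.2 ?_
  have : (0 : ℝ) ≤ k := Nat.cast_nonneg k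
  nlinarith

theorem one_le_percentileThreshold (hp : 0 < p) : 1 ≤ percentileThreshold p k := by
  rw [percentileThreshold]
  split_ifs with h
  · exact le_rfl
  · have : (0 : ℝ) < k := by exact_mod_cast Nat.pos_of_ne_zero h
    exact Nat.one_le_ceil_iff.2 (by positivity)

end Threshold

/-- The sets of ranks that can be retained after `n` observations. -/
def IsRankSet (n : ℕ) (T : Finset ℕ) : Prop := T ⊆ Finset.Icc 1 n ∧ (1 ≤ n → T.Nonempty)

theorem IsRankSet.insertRank {p : ℝ} (hp : 0 < p) {n : ℕ} {T : Finset ℕ} (hT : IsRankSet n T)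
    {r : ℕ} (hr : r ∈ Finset.Icc 1 (n + 1)) : IsRankSet (n + 1) (insertRank p T r) := by
  rw [Finset.mem_Icc] at hr
  have himg : T.image (shiftRank r) ⊆ Finset.Icc 1 (n + 1) := by
    intro a ha
    obtain ⟨t, ht, rfl⟩ := Finset.mem_image.1 ha
    have := Finset.mem_Icc.1 (hT.1 ht)
    rw [Finset.mem_Icc, shiftRank]
    split_ifs <;> omega
  constructor
  · unfold RankSelection.insertRank
    split_ifs
    · exact Finset.insert_subset (Finset.mem_Icc.2 hr) himg
    · exact himg
  · intro _
    rw [← Finset.card_pos, card_insertRank]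
    have h1 := one_le_percentileThreshold (p := p) (k := T.card) hp
    rcases Nat.eq_zero_or_pos n with rfl | hn
    · rw [if_pos (by omega)]
      omega
    · have := (hT.2 hn).card_pos
      split_ifs <;> omega

/-- Restricting the comparison to reachable sets matters: later bounds divide by the cardinality,
and they need all ranks up to the threshold to be available to the newcomer. -/
theorem rankMean_mono {p : ℝ} (hp : 0 < p) {n : ℕ} {f g : Finset ℕ → ℝ}
    (h : ∀ T, IsRankSet n T → f T ≤ g T) : rankMean p n f ≤ rankMean p n g := by
  induction n generalizing f g with
  | zero =>
    rw [rankMean_zero, rankMean_zero]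
    exact h ∅ ⟨by simp, by simp⟩
  | succ n ih =>
    rw [rankMean_succ, rankMean_succ]
    refine ih fun T hT => ?_
    have : (0 : ℝ) < n + 1 := by positivity
    gcongr with r hr
    exact h _ (hT.insertRank hp hr)

theorem rankMean_const (p : ℝ) (n : ℕ) (c : ℝ) : rankMean p n (fun _ => c) = c := by
  induction n with
  | zero => rw [rankMean_zero]
  | succ n ih =>
    have h : (n + 1 : ℝ) ≠ 0 := by positivity
    rw [rankMean_succ]
    simp [mul_div_cancel_left₀ _ h, ih]

theorem rankMean_affine (p : ℝ) (n : ℕ) (g h : Finset ℕ → ℝ) (a b c : ℝ) :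
    rankMean p n (fun T => a * g T + b * h T + c) = a * rankMean p n g + b * rankMean p n h + c := by
  have : (fun T => a * g T + b * h T + c) = a • g + b • h + fun _ => c := rfl
  rw [this, map_add, map_add, map_smul, map_smul, rankMean_const, smul_eq_mul, smul_eq_mul]

theorem rankMean_one {p : ℝ} (hp : 0 < p) (g : Finset ℕ → ℝ) : rankMean p 1 g = g {1} := by
  have h : insertRank p ∅ 1 = {1} := by
    rw [insertRank, if_pos (one_le_percentileThreshold hp)]
    rfl
  rw [rankMean_succ, rankMean_zero]
  simp [h]

theorem rankMean_succ_mul (p : ℝ) (n : ℕ) (g : Finset ℕ → ℝ) :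
    (n + 1 : ℝ) * rankMean p (n + 1) g
      = rankMean p n (fun T => ∑ r ∈ Finset.Icc 1 (n + 1), g (insertRank p T r)) := by
  have h : (n + 1 : ℝ) ≠ 0 := by positivity
  rw [rankMean_succ, ← smul_eq_mul, ← map_smul]
  congr 1
  funext T
  rw [Pi.smul_apply, smul_eq_mul, mul_div_cancel₀ _ h]

theorem sum_Icc_ite_le {n m : ℕ} (hm : m ≤ n) (f : ℕ → ℝ) :
    ∑ r ∈ Finset.Icc 1 n, (if r ≤ m then f r else 0) = ∑ r ∈ Finset.Icc 1 m, f r := by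
  rw [← Finset.sum_filter]
  congr 1
  ext r
  simp only [Finset.mem_filter, Finset.mem_Icc]
  omega

theorem sum_card_insertRank {p : ℝ} {n : ℕ} {T : Finset ℕ}
    (hm : percentileThreshold p T.card ≤ n + 1) (h : ℕ → ℝ) :
    ∑ r ∈ Finset.Icc 1 (n + 1), h (insertRank p T r).card
      = (n + 1 : ℝ) * h T.card
        + percentileThreshold p T.card * (h (T.card + 1) - h T.card) := by
  have h1 : ∀ r ∈ Finset.Icc 1 (n + 1), h (insertRank p T r).card = h T.card
      + if r ≤ percentileThreshold p T.card then h (T.card + 1) - h T.card else 0 := by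
    intro r _
    rw [card_insertRank]
    split_ifs <;> ring
  rw [Finset.sum_congr rfl h1, Finset.sum_add_distrib, sum_Icc_ite_le hm]
  simp only [Finset.sum_const, Nat.card_Icc, nsmul_eq_mul]
  push_cast
  ring

/-! ### One-step sums over the newcomer's rank -/

/-- The sum of the elements of `T`, truncated at `m`. -/
noncomputable def minSum (m : ℕ) (T : Finset ℕ) : ℝ := ∑ t ∈ T, ((min t m : ℕ) : ℝ)

/-- The sum of the elements of `T`. -/
noncomputable def elemSum (T : Finset ℕ) : ℝ := ∑ t ∈ T, (t : ℝ)

theorem elemSum_nonneg (T : Finset ℕ) : 0 ≤ elemSum T := Finset.sum_nonneg fun _ _ => by positivity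

theorem minSum_nonneg (m : ℕ) (T : Finset ℕ) : 0 ≤ minSum m T :=
  Finset.sum_nonneg fun _ _ => by positivity

theorem minSum_le_elemSum (m : ℕ) (T : Finset ℕ) : minSum m T ≤ elemSum T :=
  Finset.sum_le_sum fun t _ => by exact_mod_cast min_le_left t m

theorem minSum_le_mul (m : ℕ) (T : Finset ℕ) : minSum m T ≤ m * T.card := by
  have : minSum m T ≤ ∑ _t ∈ T, (m : ℝ) :=
    Finset.sum_le_sum fun t _ => by exact_mod_cast min_le_right t m
  simpa [mul_comm] using this

/-- Double counting: an element t is counted once for each r from 1 to min(t, m). -/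
theorem sum_card_filter_le (m : ℕ) (T : Finset ℕ) :
    ∑ r ∈ Finset.Icc 1 m, ((T.filter (fun t => r ≤ t)).card : ℝ) = minSum m T := by
  simp only [Finset.card_filter, Nat.cast_sum]
  rw [Finset.sum_comm, minSum]
  refine Finset.sum_congr rfl fun t _ => ?_
  rw [← Nat.cast_sum, ← Finset.card_filter]
  congr 1
  have : (Finset.Icc 1 m).filter (fun r => r ≤ t) = Finset.Icc 1 (min t m) := by
    ext r
    simp only [Finset.mem_filter, Finset.mem_Icc]
    omega
  rw [this]
  simp

theorem sum_card_filter_eq {n : ℕ} {T : Finset ℕ} (hT : T ⊆ Finset.Icc 1 n) :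
    ∑ r ∈ Finset.Icc 1 (n + 1), ((T.filter (fun t => r ≤ t)).card : ℝ) = elemSum T := by
  rw [sum_card_filter_le, minSum, elemSum]
  refine Finset.sum_congr rfl fun t ht => ?_
  have := Finset.mem_Icc.1 (hT ht)
  rw [min_eq_left (by omega)]

theorem sum_Icc_cast (m : ℕ) : ∑ r ∈ Finset.Icc 1 m, (r : ℝ) = m * (m + 1) / 2 := by
  induction m with
  | zero => simp
  | succ m ih =>
    rw [Finset.sum_Icc_succ_top (by omega), ih]
    push_cast
    ring

/-- Over all r, the upward shifts add Q in total. The m retained newcomers change the weight; they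
cause shifts summing to `minSum` and bring in their own ranks, with sum m(m+1)/2. The weight f is
left free so that 1/k, 1/(k(k-1)), 1/(k + 2/p) and the indicator of k = 1 can all be used. -/
theorem sum_elemSum_insertRank {p : ℝ} {n : ℕ} {T : Finset ℕ} (hT : T ⊆ Finset.Icc 1 n)
    (hm : percentileThreshold p T.card ≤ n + 1) (f : ℕ → ℝ) :
    ∑ r ∈ Finset.Icc 1 (n + 1), elemSum (insertRank p T r) * f (insertRank p T r).card
      = (n + 1 + 1 : ℝ) * (elemSum T * f T.card)
        + (f (T.card + 1) - f T.card) * (percentileThreshold p T.card * elemSum T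
          + minSum (percentileThreshold p T.card) T)
        + f (T.card + 1) * (percentileThreshold p T.card
          * (percentileThreshold p T.card + 1) / 2) := by
  have h1 : ∀ r ∈ Finset.Icc 1 (n + 1),
      elemSum (insertRank p T r) * f (insertRank p T r).card
        = f T.card * (elemSum T + ((T.filter (fun t => r ≤ t)).card : ℝ))
          + if r ≤ percentileThreshold p T.card then
              (f (T.card + 1) - f T.card) * (elemSum T + ((T.filter (fun t => r ≤ t)).card : ℝ))
                + f (T.card + 1) * r
            else 0 := by
    intro r _
    have h2 := congrArg (Nat.cast (R := ℝ)) (sum_insertRank p T r)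
    push_cast at h2
    rw [card_insertRank, elemSum, h2, elemSum]
    split_ifs <;> ring
  rw [Finset.sum_congr rfl h1, Finset.sum_add_distrib, sum_Icc_ite_le hm, Finset.sum_add_distrib,
    ← Finset.mul_sum, ← Finset.mul_sum, ← Finset.mul_sum, Finset.sum_add_distrib,
    Finset.sum_add_distrib, sum_card_filter_eq hT, sum_card_filter_le, sum_Icc_cast]
  simp
  ring

/-! ### Recursions for the means of L, A and the auxiliary quantities -/

section Recursions

variable {p : ℝ} {n : ℕ}

theorem IsRankSet.one_le_card {T : Finset ℕ} (hn : 1 ≤ n) (hT : IsRankSet n T) : 1 ≤ T.card :=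
  (hT.2 hn).card_pos

theorem IsRankSet.percentileThreshold_le (hp1 : p ≤ 1) (hn : 1 ≤ n) {T : Finset ℕ}
    (hT : IsRankSet n T) : percentileThreshold p T.card ≤ n + 1 := by
  have h1 := RankSelection.percentileThreshold_le hp1 (hT.one_le_card hn)
  have h2 := Finset.card_le_card hT.1
  simp only [Nat.card_Icc] at h2
  omega

theorem rankMean_card_succ (hp : 0 < p) (hp1 : p ≤ 1) (hn : 1 ≤ n) :
    (n + 1 + p) * rankMean p n (fun T => (T.card : ℝ))
        ≤ (n + 1 : ℝ) * rankMean p (n + 1) (fun T => (T.card : ℝ)) ∧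
      (n + 1 : ℝ) * rankMean p (n + 1) (fun T => (T.card : ℝ))
        ≤ (n + 1 + p) * rankMean p n (fun T => (T.card : ℝ)) + 1 := by
  have key : ∀ T, IsRankSet n T → ∑ r ∈ Finset.Icc 1 (n + 1), ((insertRank p T r).card : ℝ)
      = (n + 1 : ℝ) * T.card + percentileThreshold p T.card := by
    intro T hT
    rw [sum_card_insertRank (hT.percentileThreshold_le hp1 hn) (fun k => (k : ℝ))]
    push_cast
    ring
  have e1 := rankMean_affine p n (fun T => (T.card : ℝ)) (fun _ => 0) (n + 1 + p) 0 0
  have e2 := rankMean_affine p n (fun T => (T.card : ℝ)) (fun _ => 0) (n + 1 + p) 0 1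
  simp only [zero_mul, add_zero] at e1 e2
  rw [rankMean_succ_mul, ← e2, ← e1]
  refine ⟨rankMean_mono hp fun T hT => ?_, rankMean_mono hp fun T hT => ?_⟩
  · have := le_percentileThreshold (p := p) (hT.one_le_card hn)
    rw [key T hT]
    linarith
  · have := percentileThreshold_lt hp (hT.one_le_card hn)
    rw [key T hT]
    linarith

theorem avgElem_eq (T : Finset ℕ) : avgElem T = elemSum T * (T.card : ℝ)⁻¹ := rfl

/-- Since m = pL + O(1), the weight change -1/(L(L+1)) applied to mQ gives about -pQ/L, and the
inserted ranks give about m²/(2L), that is p²L/2. The three remainders are bounded by Q/(L(L+1)),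
because |p(L+1) - m| ≤ 1, and by the constants 1 and 2. -/
theorem avgElem_step_bound {N L m Q M : ℝ} (hp : 0 < p) (hp1 : p ≤ 1) (hL : 1 ≤ L)
    (hm : p * L ≤ m) (hm' : m ≤ p * L + 1) (hmL : m ≤ L) (hQ : 0 ≤ Q) (hM : 0 ≤ M)
    (hM' : M ≤ m * L) :
    |(N + 1) * (Q * L⁻¹) + ((L + 1)⁻¹ - L⁻¹) * (m * Q + M) + (L + 1)⁻¹ * (m * (m + 1) / 2)
      - ((N + 1 - p) * (Q * L⁻¹) + p ^ 2 / 2 * L)| ≤ Q * (L * (L + 1))⁻¹ + 3 := by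
  have hL0 : 0 < L := by linarith
  have hLL : 0 < L * (L + 1) := by positivity
  have e : (N + 1) * (Q * L⁻¹) + ((L + 1)⁻¹ - L⁻¹) * (m * Q + M) + (L + 1)⁻¹ * (m * (m + 1) / 2)
      - ((N + 1 - p) * (Q * L⁻¹) + p ^ 2 / 2 * L)
      = Q * (L * (L + 1))⁻¹ * (p * (L + 1) - m) - M / (L * (L + 1))
        + (m * (m + 1) - p ^ 2 * L * (L + 1)) / (2 * (L + 1)) := by
    field_simp
    ring
  have hw : 0 ≤ Q * (L * (L + 1))⁻¹ := by positivity
  have h1 : |Q * (L * (L + 1))⁻¹ * (p * (L + 1) - m)| ≤ Q * (L * (L + 1))⁻¹ := by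
    rw [abs_mul, abs_of_nonneg hw]
    refine mul_le_of_le_one_right hw (abs_le.2 ⟨by linarith, by linarith⟩)
  have h2 : |M / (L * (L + 1))| ≤ 1 := by
    rw [abs_of_nonneg (by positivity), div_le_one hLL]
    nlinarith
  have h3 : |(m * (m + 1) - p ^ 2 * L * (L + 1)) / (2 * (L + 1))| ≤ 2 := by
    have hpL : 0 ≤ p * L := by positivity
    have hpp : p ^ 2 * L ≤ p * L := by nlinarith
    have hpL' : p * L ≤ L := by nlinarith
    rw [abs_of_nonneg, div_le_iff₀ (by positivity)]
    · nlinarith [mul_self_nonneg (p * L)]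
    · refine div_nonneg ?_ (by positivity)
      nlinarith
  rw [e]
  refine (abs_add_le _ _).trans ((add_le_add (abs_sub _ _) le_rfl).trans ?_)
  linarith

theorem rankMean_avgElem_succ (hp : 0 < p) (hp1 : p ≤ 1) (hn : 1 ≤ n) :
    |(n + 1 : ℝ) * rankMean p (n + 1) avgElem - ((n + 1 + 1 - p) * rankMean p n avgElem
      + p ^ 2 / 2 * rankMean p n (fun T => (T.card : ℝ)))|
      ≤ rankMean p n (fun T => elemSum T * ((T.card : ℝ) * (T.card + 1))⁻¹) + 3 := by
  set w : Finset ℕ → ℝ := fun T => elemSum T * ((T.card : ℝ) * (T.card + 1))⁻¹ with hw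
  set D : Finset ℕ → ℝ := fun T => 1 * (∑ r ∈ Finset.Icc 1 (n + 1), avgElem (insertRank p T r))
    + (-1) * (((n + 1 + 1 - p) * avgElem T + p ^ 2 / 2 * T.card + 0)) + 0 with hD
  have key : ∀ T, IsRankSet n T → |D T| ≤ w T + 3 := by
    intro T hT
    have hL := hT.one_le_card hn
    have h := avgElem_step_bound (N := n + 1) hp hp1 (L := T.card) (by exact_mod_cast hL)
      (le_percentileThreshold hL) (percentileThreshold_lt hp hL).le
      (by exact_mod_cast percentileThreshold_le hp1 hL) (elemSum_nonneg T)
      (minSum_nonneg (percentileThreshold p T.card) T) (minSum_le_mul _ T)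
    have h2 := sum_elemSum_insertRank hT.1 (hT.percentileThreshold_le hp1 hn)
      (fun k => (k : ℝ)⁻¹)
    simp only [← avgElem_eq] at h2
    push_cast at h2
    simp only [hD]
    rw [h2, one_mul, add_zero, add_zero, neg_one_mul, ← sub_eq_add_neg]
    exact h
  have e1 := rankMean_affine p n
    (fun T => ∑ r ∈ Finset.Icc 1 (n + 1), avgElem (insertRank p T r))
    (fun T => (n + 1 + 1 - p) * avgElem T + p ^ 2 / 2 * T.card + 0) 1 (-1) 0
  rw [rankMean_affine p n avgElem, ← rankMean_succ_mul] at e1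
  have e2 := rankMean_affine p n w (fun _ => 0) 1 0 3
  have e3 := rankMean_affine p n w (fun _ => 0) (-1) 0 (-3)
  simp only [zero_mul, add_zero, one_mul] at e2 e3
  have e4 : (n + 1 : ℝ) * rankMean p (n + 1) avgElem - ((n + 1 + 1 - p) * rankMean p n avgElem
      + p ^ 2 / 2 * rankMean p n (fun T => (T.card : ℝ))) = rankMean p n D := by
    rw [hD, e1]
    ring
  rw [e4, abs_le]
  constructor
  · have : -(rankMean p n w + 3) = -1 * rankMean p n w + -3 := by ring
    rw [this, ← e3]
    refine rankMean_mono hp fun T hT => ?_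
    have := (abs_le.1 (key T hT)).1
    linarith
  · rw [← e2]
    exact rankMean_mono hp fun T hT => (abs_le.1 (key T hT)).2

/-- The sum of the elements of `T` if `T` is a singleton, and `0` otherwise. -/
noncomputable def singletonSum (T : Finset ℕ) : ℝ := elemSum T * if T.card = 1 then 1 else 0

theorem singletonSum_nonneg (T : Finset ℕ) : 0 ≤ singletonSum T :=
  mul_nonneg (elemSum_nonneg T) (by split_ifs <;> norm_num)

/-- With one item kept, the threshold is 1: a newcomer of rank 1 makes the indicator vanish, and
this loss of at least Q offsets the total gain Q from the shifts. The mean therefore does not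
increase. -/
theorem rankMean_singletonSum_le (hp : 0 < p) (hp1 : p ≤ 1) (hn : 1 ≤ n) :
    rankMean p n singletonSum ≤ 1 := by
  induction n, hn using Nat.le_induction with
  | base =>
    rw [rankMean_one hp]
    simp [singletonSum, elemSum]
  | succ n hn ih =>
    refine le_trans ?_ ih
    have h0 : (0 : ℝ) < n + 1 := by positivity
    refine le_of_mul_le_mul_left ?_ h0
    have e := rankMean_affine p n singletonSum (fun _ => 0) (n + 1) 0 0
    simp only [zero_mul, add_zero] at e
    rw [rankMean_succ_mul, ← e]
    refine rankMean_mono hp fun T hT => ?_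
    have hL := hT.one_le_card hn
    have h2 := sum_elemSum_insertRank hT.1 (hT.percentileThreshold_le hp1 hn)
      (fun k => if k = 1 then (1 : ℝ) else 0)
    have hm : (1 : ℝ) ≤ percentileThreshold p T.card := by
      exact_mod_cast one_le_percentileThreshold hp
    have hM := minSum_nonneg (percentileThreshold p T.card) T
    have hQ := elemSum_nonneg T
    simp only [singletonSum]
    rw [h2]
    by_cases h : T.card = 1
    · rw [h] at hm hM ⊢
      norm_num
      nlinarith
    · simp [h, show T.card ≠ 0 by omega]

/-- The sum of the elements of `T` divided by `|T| (|T| - 1)` (and `0` if `|T| ≤ 1`). -/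
noncomputable def scaledSum (T : Finset ℕ) : ℝ :=
  elemSum T * ((T.card : ℝ) * (T.card - 1))⁻¹

/-- Going from L to L + 1 costs the weight 1/(L(L-1)) a fraction 2/(L+1) of itself. Multiplied by m
≥ pL this is at least 2pL/(L+1) ≥ 4p/3 once L ≥ 2, a faster decay than the p governing Q/L. -/
theorem scaledSum_step_bound {N L m Q M : ℝ} (hp : 0 < p) (hL : 2 ≤ L)
    (hm : p * L ≤ m) (hmL : m ≤ L) (hQ : 0 ≤ Q) (hM : 0 ≤ M) :
    (N + 1) * (Q * (L * (L - 1))⁻¹) + (((L + 1) * L)⁻¹ - (L * (L - 1))⁻¹) * (m * Q + M)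
      + ((L + 1) * L)⁻¹ * (m * (m + 1) / 2)
      ≤ (N + 1 - 4 * p / 3) * (Q * (L * (L - 1))⁻¹) + 1 := by
  have hL1 : 0 < L - 1 := by linarith
  have hL0 : 0 < L := by linarith
  have e : ((L + 1) * L)⁻¹ - (L * (L - 1))⁻¹ = - (2 / (L + 1) * (L * (L - 1))⁻¹) := by
    field_simp
    ring
  have h1 : ((L + 1) * L)⁻¹ * (m * (m + 1) / 2) ≤ 1 := by
    rw [inv_mul_le_iff₀ (by positivity)]
    nlinarith [mul_nonneg hp.le hL0.le]
  have h2 : 4 * p / 3 ≤ 2 / (L + 1) * m := by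
    rw [div_mul_eq_mul_div, div_le_div_iff₀ (by norm_num) (by linarith)]
    nlinarith
  have hf : 0 ≤ (L * (L - 1))⁻¹ := by positivity
  have h3 : 0 ≤ 2 / (L + 1) * (L * (L - 1))⁻¹ * M := by positivity
  have h4 := mul_le_mul_of_nonneg_right h2 (mul_nonneg hQ hf)
  rw [e]
  linarith

theorem rankMean_scaledSum_succ (hp : 0 < p) (hp1 : p ≤ 1) (hn : 1 ≤ n) :
    (n + 1 : ℝ) * rankMean p (n + 1) scaledSum
      ≤ (n + 1 + 1 - 4 * p / 3) * rankMean p n scaledSum + 2 := by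
  have e := rankMean_affine p n scaledSum singletonSum (n + 1 + 1 - 4 * p / 3) 1 1
  have hs := rankMean_singletonSum_le hp hp1 hn
  have : rankMean p n (fun T => ∑ r ∈ Finset.Icc 1 (n + 1), scaledSum (insertRank p T r))
      ≤ rankMean p n (fun T => (n + 1 + 1 - 4 * p / 3) * scaledSum T + 1 * singletonSum T + 1) := by
    refine rankMean_mono hp fun T hT => ?_
    have hL := hT.one_le_card hn
    have h2 := sum_elemSum_insertRank hT.1 (hT.percentileThreshold_le hp1 hn)
      (fun k => ((k : ℝ) * (k - 1))⁻¹)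
    have hm := le_percentileThreshold (p := p) hL
    have hmL := percentileThreshold_le hp1 hL
    have hM := minSum_nonneg (percentileThreshold p T.card) T
    have hM' := minSum_le_elemSum (percentileThreshold p T.card) T
    have hQ := elemSum_nonneg T
    have hs := singletonSum_nonneg T
    simp only [scaledSum]
    rw [h2]
    -- For L = 1 the weight is 1/0 = 0, so what appears when a second item is kept is charged to
    -- `singletonSum`.
    rcases Nat.lt_or_ge T.card 2 with h | h
    · have h1 : T.card = 1 := by omega
      have hm1 : percentileThreshold p 1 = 1 :=
        le_antisymm (percentileThreshold_le hp1 le_rfl) (one_le_percentileThreshold hp)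
      simp only [h1, hm1, singletonSum] at hM' ⊢
      norm_num
      linarith
    · have := scaledSum_step_bound (N := n + 1) hp (L := T.card) (by exact_mod_cast h) hm
        (by exact_mod_cast hmL) hQ hM
      push_cast
      rw [add_sub_cancel_right]
      linarith
  rw [rankMean_succ_mul]
  linarith

theorem rankMean_scaledSum_nonneg (hp : 0 < p) (hn : 1 ≤ n) : 0 ≤ rankMean p n scaledSum := by
  rw [← rankMean_const p n 0]
  refine rankMean_mono hp fun T hT => ?_
  have hL : (1 : ℝ) ≤ T.card := by exact_mod_cast hT.one_le_card hn
  have : (0 : ℝ) ≤ T.card - 1 := by linarith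
  exact mul_nonneg (elemSum_nonneg T) (by positivity)

theorem rankMean_error_le (hp : 0 < p) (hp1 : p ≤ 1) (hn : 1 ≤ n) :
    rankMean p n (fun T => elemSum T * ((T.card : ℝ) * (T.card + 1))⁻¹)
      ≤ rankMean p n scaledSum + 1 := by
  have e := rankMean_affine p n scaledSum singletonSum 1 1 0
  have hs := rankMean_singletonSum_le hp hp1 hn
  have : rankMean p n (fun T => elemSum T * ((T.card : ℝ) * (T.card + 1))⁻¹)
      ≤ rankMean p n (fun T => 1 * scaledSum T + 1 * singletonSum T + 0) := by
    refine rankMean_mono hp fun T hT => ?_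
    have hL := hT.one_le_card hn
    have hQ := elemSum_nonneg T
    have hs := singletonSum_nonneg T
    rcases Nat.lt_or_ge T.card 2 with h | h
    · have h1 : T.card = 1 := by omega
      simp only [scaledSum, singletonSum, h1]
      norm_num
      linarith
    · have hL2 : (2 : ℝ) ≤ T.card := by exact_mod_cast h
      have : elemSum T * ((T.card : ℝ) * (T.card + 1))⁻¹ ≤ scaledSum T := by
        unfold scaledSum
        gcongr
        · nlinarith
        · linarith
      linarith
  linarith

/-- A lower bound for the average of the elements of `T` whose mean grows at the right rate. -/
noncomputable def shiftedAvg (p : ℝ) (T : Finset ℕ) : ℝ := elemSum T * ((T.card : ℝ) + 2 / p)⁻¹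

/-- The offset 2/p absorbs the rounding: (m+1)/(L+1+2/p) ≤ p, while mQ + `minSum` ≤ (m+1)Q. So the
weight change costs at most a proportion p, and the ranks inserted are dropped as nonnegative. -/
theorem rankMean_shiftedAvg_succ (hp : 0 < p) (hp1 : p ≤ 1) (hn : 1 ≤ n) :
    (n + 1 + (1 - p)) * rankMean p n (shiftedAvg p)
      ≤ (n + 1 : ℝ) * rankMean p (n + 1) (shiftedAvg p) := by
  have e := rankMean_affine p n (shiftedAvg p) (fun _ => 0) (n + 1 + (1 - p)) 0 0
  simp only [zero_mul, add_zero] at e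
  rw [rankMean_succ_mul, ← e]
  refine rankMean_mono hp fun T hT => ?_
  have hL := hT.one_le_card hn
  have h2 := sum_elemSum_insertRank hT.1 (hT.percentileThreshold_le hp1 hn)
    (fun k => ((k : ℝ) + 2 / p)⁻¹)
  have hm := percentileThreshold_lt hp hL
  have hM' := minSum_le_elemSum (percentileThreshold p T.card) T
  have hQ := elemSum_nonneg T
  simp only [shiftedAvg]
  rw [h2]
  push_cast
  generalize (percentileThreshold p T.card : ℕ) = m at *
  have hm0 : (0 : ℝ) ≤ m := Nat.cast_nonneg m
  have hK : 0 < (T.card : ℝ) + 2 / p := by positivity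
  have hK1 : 0 < (T.card : ℝ) + 1 + 2 / p := by positivity
  have e1 : ((T.card : ℝ) + 1 + 2 / p)⁻¹ - ((T.card : ℝ) + 2 / p)⁻¹
      = -(((T.card : ℝ) + 1 + 2 / p)⁻¹ * ((T.card : ℝ) + 2 / p)⁻¹) := by
    rw [inv_sub_inv hK1.ne' hK.ne', ← mul_inv]
    ring
  have h3 : ((T.card : ℝ) + 1 + 2 / p)⁻¹ * (m + 1) ≤ p := by
    rw [inv_mul_le_iff₀ hK1]
    have : ((T.card : ℝ) + 1 + 2 / p) * p = p * T.card + p + 2 := by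
      field_simp
    linarith
  have h4 := mul_le_mul_of_nonneg_right h3 (mul_nonneg hQ (inv_pos.2 hK).le)
  have h5 : 0 ≤ ((T.card : ℝ) + 1 + 2 / p)⁻¹ * (m * (m + 1) / 2) := by positivity
  have h6 : ((T.card : ℝ) + 1 + 2 / p)⁻¹ * ((T.card : ℝ) + 2 / p)⁻¹ * minSum m T
      ≤ ((T.card : ℝ) + 1 + 2 / p)⁻¹ * ((T.card : ℝ) + 2 / p)⁻¹ * elemSum T := by gcongr
  rw [e1]
  linarith

theorem rankMean_shiftedAvg_le (hp : 0 < p) (hn : 1 ≤ n) :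
    rankMean p n (shiftedAvg p) ≤ rankMean p n avgElem := by
  refine rankMean_mono hp fun T hT => ?_
  have hL : (1 : ℝ) ≤ T.card := by exact_mod_cast hT.one_le_card hn
  have hQ := elemSum_nonneg T
  have : 0 < 2 / p := by positivity
  rw [avgElem_eq, shiftedAvg]
  gcongr
  linarith

theorem rankMean_one_shiftedAvg_pos (hp : 0 < p) : 0 < rankMean p 1 (shiftedAvg p) := by
  rw [rankMean_one hp]
  simp only [shiftedAvg, elemSum, Finset.sum_singleton, Finset.card_singleton]
  positivity

end Recursions

/-! ### Integrating factors and asymptotics of linear recursions -/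

/-- The product `∏_{k=1}^n (1 + a / k)`. -/
noncomputable def rising (a : ℝ) (n : ℕ) : ℝ := ∏ k ∈ Finset.range n, (1 + a / (k + 1))

theorem rising_pos {a : ℝ} (ha : 0 ≤ a) (n : ℕ) : 0 < rising a n :=
  Finset.prod_pos fun _ _ => by positivity

theorem rising_succ (a : ℝ) (n : ℕ) : rising a (n + 1) = rising a n * (1 + a / (n + 1)) :=
  Finset.prod_range_succ _ _

theorem succ_mul_rising_succ (a : ℝ) (n : ℕ) :
    (n + 1 : ℝ) * rising a (n + 1) = (n + 1 + a) * rising a n := by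
  have : (n + 1 : ℝ) ≠ 0 := by positivity
  rw [rising_succ]
  field_simp

theorem prod_add_eq_factorial_mul_rising (a : ℝ) (n : ℕ) :
    ∏ j ∈ Finset.range n, (a + 1 + j) = n.factorial * rising a n := by
  induction n with
  | zero => simp [rising]
  | succ n ih =>
    rw [Finset.prod_range_succ, ih, Nat.factorial_succ]
    push_cast
    linear_combination -(n.factorial : ℝ) * succ_mul_rising_succ a n

/-- Euler's limit for the Gamma function: `GammaSeq (a + 1) n` is n^a / `rising a n` times
n/(n+a+1). -/
theorem tendsto_rising {a : ℝ} (ha : 0 ≤ a) :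
    Tendsto (fun n : ℕ => rising a n / (n : ℝ) ^ a) atTop (𝓝 (Real.Gamma (a + 1))⁻¹) := by
  have hG : Real.Gamma (a + 1) ≠ 0 := (Real.Gamma_pos_of_pos (by linarith)).ne'
  have h := ((Real.GammaSeq_tendsto_Gamma (a + 1)).inv₀ hG).mul
    (tendsto_natCast_div_add_atTop (a + 1))
  rw [mul_one] at h
  refine h.congr' ?_
  filter_upwards [eventually_ge_atTop 1] with n hn
  have hn' : (0 : ℝ) < n := by exact_mod_cast hn
  have hr := rising_pos ha n
  have hf : (0 : ℝ) < n.factorial := by exact_mod_cast n.factorial_pos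
  have hpow : (0 : ℝ) < (n : ℝ) ^ a := Real.rpow_pos_of_pos hn' a
  rw [Real.GammaSeq, Finset.prod_range_succ, prod_add_eq_factorial_mul_rising,
    Real.rpow_add_one hn'.ne']
  have : (0 : ℝ) < a + 1 + n := by positivity
  field_simp
  ring

theorem Gamma_inv_pos {a : ℝ} (ha : 0 ≤ a) : 0 < (Real.Gamma (a + 1))⁻¹ :=
  inv_pos.2 (Real.Gamma_pos_of_pos (by linarith))

theorem tendsto_rising_succ {a : ℝ} (ha : 0 ≤ a) :
    Tendsto (fun n : ℕ => rising a (n + 1) / (n : ℝ) ^ a) atTop (𝓝 (Real.Gamma (a + 1))⁻¹) := by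
  have h1 : Tendsto (fun n : ℕ => 1 + a * (1 / ((n : ℝ) + 1))) atTop (𝓝 (1 + a * 0)) :=
    (tendsto_one_div_add_atTop_nhds_zero_nat.const_mul a).const_add 1
  have h := (tendsto_rising ha).mul h1
  rw [mul_zero, add_zero, mul_one] at h
  refine h.congr fun n => ?_
  rw [rising_succ]
  ring

theorem rising_isBigO {a : ℝ} (ha : 0 ≤ a) :
    (fun n : ℕ => rising a n) =O[atTop] fun n : ℕ => (n : ℝ) ^ a := by
  refine Asymptotics.isBigO_of_div_tendsto_nhds ?_ _ (tendsto_rising ha)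
  filter_upwards [eventually_ge_atTop 1] with n hn h
  have hn' : (0 : ℝ) < n := by exact_mod_cast hn
  exact absurd h (Real.rpow_pos_of_pos hn' a).ne'

theorem rising_inv_isBigO {a : ℝ} (ha : 0 ≤ a) :
    (fun n : ℕ => (rising a n)⁻¹) =O[atTop] fun n : ℕ => (n : ℝ) ^ (-a) := by
  have h := (tendsto_rising ha).inv₀ (Gamma_inv_pos ha).ne'
  refine Asymptotics.isBigO_of_div_tendsto_nhds ?_ (Real.Gamma (a + 1))⁻¹⁻¹ (h.congr fun n => ?_)
  · filter_upwards [eventually_ge_atTop 1] with n hn h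
    have hn' : (0 : ℝ) < n := by exact_mod_cast hn
    exact absurd h (Real.rpow_pos_of_pos hn' (-a)).ne'
  · simp only [Pi.div_apply]
    rw [Real.rpow_neg (Nat.cast_nonneg n), inv_div, div_inv_eq_mul, div_eq_mul_inv, mul_comm]

theorem div_rising_succ_sub {a : ℝ} (ha : 0 ≤ a) (u : ℕ → ℝ) (n : ℕ) :
    u (n + 1) / rising a (n + 1) - u n / rising a n
      = ((n + 1 : ℝ) * u (n + 1) - (n + 1 + a) * u n) / ((n + 1) * rising a (n + 1)) := by
  have h1 := (rising_pos ha n).ne'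
  have h2 : (n + 1 : ℝ) ≠ 0 := by positivity
  have h3 : (n + 1 + a : ℝ) ≠ 0 := by positivity
  rw [sub_div, mul_div_mul_left _ _ h2, succ_mul_rising_succ, mul_div_mul_left _ _ h3]

/-- Division by the integrating factor turns the recursion into a telescoping sum with increments
O(n^(s-1-a)), which is summable as s < a. -/
theorem exists_tendsto_div_rising {a s : ℝ} (ha : 0 ≤ a) (hs : s < a) {u : ℕ → ℝ}
    (h : (fun n : ℕ => (n + 1 : ℝ) * u (n + 1) - (n + 1 + a) * u n)
      =O[atTop] fun n : ℕ => (n : ℝ) ^ s) :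
    ∃ l, Tendsto (fun n => u n / rising a n) atTop (𝓝 l) := by
  have hinv : (fun n : ℕ => ((n : ℝ) + 1 + a)⁻¹) =O[atTop] fun n : ℕ => (n : ℝ) ^ (-1 : ℝ) := by
    refine Asymptotics.IsBigO.of_bound 1 ?_
    filter_upwards [eventually_ge_atTop 1] with n hn
    have hn' : (0 : ℝ) < n := by exact_mod_cast hn
    rw [one_mul, Real.rpow_neg_one, Real.norm_of_nonneg (by positivity),
      Real.norm_of_nonneg (by positivity)]
    gcongr
    linarith
  have hsum : Summable fun n => u (n + 1) / rising a (n + 1) - u n / rising a n := by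
    refine summable_of_isBigO_nat (Real.summable_nat_rpow.2 (show s + (-1 + -a) < -1 by linarith)) ?_
    refine (h.mul (hinv.mul (rising_inv_isBigO ha))).congr' ?_ ?_
    · refine Eventually.of_forall fun n => ?_
      simp only
      rw [div_rising_succ_sub ha, succ_mul_rising_succ, ← mul_inv, div_eq_mul_inv]
    · filter_upwards [eventually_ge_atTop 1] with n hn
      have hn' : (0 : ℝ) < n := by exact_mod_cast hn
      rw [Real.rpow_add hn', Real.rpow_add hn']
  have ht := hsum.tendsto_sum_tsum_nat
  simp only [Finset.sum_range_sub (fun n => u n / rising a n)] at ht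
  refine ⟨_, (ht.add_const (u 0 / rising a 0)).congr fun n => ?_⟩
  ring

theorem le_rising_of_succ_le {a : ℝ} (ha : 0 ≤ a) {u : ℕ → ℝ}
    (h : ∀ n : ℕ, 1 ≤ n → (n + 1 : ℝ) * u (n + 1) ≤ (n + 1 + a) * u n) {n : ℕ} (hn : 1 ≤ n) :
    u n / rising a n ≤ u 1 / rising a 1 := by
  induction n, hn using Nat.le_induction with
  | base => exact le_rfl
  | succ n hn ih =>
    refine le_trans ?_ ih
    rw [← sub_nonpos, div_rising_succ_sub ha]
    have := rising_pos ha (n + 1)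
    exact div_nonpos_of_nonpos_of_nonneg (sub_nonpos.2 (h n hn)) (by positivity)

theorem rising_le_of_le_succ {a : ℝ} (ha : 0 ≤ a) {u : ℕ → ℝ}
    (h : ∀ n : ℕ, 1 ≤ n → (n + 1 + a) * u n ≤ (n + 1 : ℝ) * u (n + 1)) {n : ℕ} (hn : 1 ≤ n) :
    u 1 / rising a 1 ≤ u n / rising a n := by
  have := le_rising_of_succ_le ha (u := fun n => -u n)
    (fun n hn => by linarith [h n hn]) hn
  rw [neg_div, neg_div] at this
  linarith

theorem isBigO_of_succ_le {a b : ℝ} (ha : 0 < a) {u : ℕ → ℝ} (hb : 0 ≤ b)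
    (hu : ∀ n : ℕ, 1 ≤ n → 0 ≤ u n)
    (h : ∀ n : ℕ, 1 ≤ n → (n + 1 : ℝ) * u (n + 1) ≤ (n + 1 + a) * u n + b) :
    u =O[atTop] fun n : ℕ => (n : ℝ) ^ a := by
  refine Asymptotics.IsBigO.trans ?_ (rising_isBigO ha.le)
  refine Asymptotics.IsBigO.of_bound ((u 1 + b / a) / rising a 1) ?_
  filter_upwards [eventually_ge_atTop 1] with n hn
  have hr := rising_pos ha.le n
  -- The shift by b/a absorbs the inhomogeneous term, since (n+1+a)(b/a) = (n+1)(b/a) + b.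
  have h1 := le_rising_of_succ_le ha.le (u := fun n => u n + b / a) (fun n hn => by
    have h2 : a * (b / a) = b := by field_simp
    linarith [h n hn]) hn
  rw [div_le_iff₀ hr] at h1
  rw [Real.norm_of_nonneg (hu n hn), Real.norm_of_nonneg hr.le]
  have : 0 ≤ b / a := by positivity
  linarith

/-- The Stolz-Cesàro theorem. -/
theorem tendsto_div_of_tendsto_sub_div {v w : ℕ → ℝ} {l : ℝ} (hw : ∀ n, 0 < w (n + 1) - w n)
    (hw' : Tendsto w atTop atTop)
    (h : Tendsto (fun n => (v (n + 1) - v n) / (w (n + 1) - w n)) atTop (𝓝 l)) :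
    Tendsto (fun n => v n / w n) atTop (𝓝 l) := by
  have h1 : (fun n => (v (n + 1) - v n) - l * (w (n + 1) - w n))
      =o[atTop] fun n => w (n + 1) - w n := by
    rw [Asymptotics.isLittleO_iff_tendsto fun n hn => absurd hn (hw n).ne']
    have h2 := h.sub_const l
    rw [sub_self] at h2
    refine h2.congr fun n => ?_
    rw [sub_div (v (n + 1) - v n), mul_div_cancel_right₀ _ (hw n).ne']
  have hs : Tendsto (fun n => ∑ i ∈ Finset.range n, (w (i + 1) - w i)) atTop atTop := by
    simp only [Finset.sum_range_sub]
    exact tendsto_atTop_add_const_right _ _ hw'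
  have h2 := h1.sum_range (fun n => (hw n).le) hs
  have h2' : (fun n => (v n - v 0) - l * (w n - w 0)) =o[atTop] fun n => w n - w 0 := by
    refine h2.congr (fun n => ?_) fun n => Finset.sum_range_sub w n
    rw [Finset.sum_sub_distrib, ← Finset.mul_sum, Finset.sum_range_sub, Finset.sum_range_sub]
  have h3 : (fun n => w n - w 0) =O[atTop] w := by
    refine (Asymptotics.isBigO_refl w atTop).sub ?_
    exact (Asymptotics.isLittleO_const_left.2 (Or.inr (tendsto_norm_atTop_atTop.comp hw'))).isBigO
  have h4 := (h2'.trans_isBigO h3).tendsto_div_nhds_zero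
  have h5 : Tendsto (fun n => (v 0 - l * w 0) / w n) atTop (𝓝 0) :=
    Tendsto.div_atTop tendsto_const_nhds hw'
  have h6 := (h4.add h5).const_add l
  simp only [add_zero] at h6
  refine h6.congr' ?_
  filter_upwards [hw'.eventually_gt_atTop 0] with n hn
  field_simp
  ring

theorem tendsto_rising_atTop {a : ℝ} (ha : 0 < a) : Tendsto (rising a) atTop atTop := by
  have h := Tendsto.pos_mul_atTop (Gamma_inv_pos ha.le) (tendsto_rising ha.le)
    ((tendsto_rpow_atTop ha).comp tendsto_natCast_atTop_atTop)
  refine h.congr' ?_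
  filter_upwards [eventually_ge_atTop 1] with n hn
  have hn' : (0 : ℝ) < n := by exact_mod_cast hn
  exact div_mul_cancel₀ _ (Real.rpow_pos_of_pos hn' a).ne'

theorem tendsto_harmonic_div_log :
    Tendsto (fun n : ℕ => (harmonic n : ℝ) / Real.log n) atTop (𝓝 1) := by
  have hlog : Tendsto (fun n : ℕ => Real.log n) atTop atTop :=
    Real.tendsto_log_atTop.comp tendsto_natCast_atTop_atTop
  have h := (Real.tendsto_harmonic_sub_log.div_atTop hlog).add_const 1
  rw [zero_add] at h
  refine h.congr' ?_
  filter_upwards [hlog.eventually_gt_atTop 0] with n hn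
  field_simp
  ring

theorem tendsto_harmonic_atTop : Tendsto (fun n : ℕ => (harmonic n : ℝ)) atTop atTop := by
  have hlog : Tendsto (fun n : ℕ => Real.log n) atTop atTop :=
    Real.tendsto_log_atTop.comp tendsto_natCast_atTop_atTop
  refine (Tendsto.atTop_add hlog Real.tendsto_harmonic_sub_log).congr fun n => ?_
  ring

theorem isLittleO_rpow_natCast {s t : ℝ} (h : s < t) :
    (fun n : ℕ => (n : ℝ) ^ s) =o[atTop] fun n : ℕ => (n : ℝ) ^ t := by
  have h1 := (tendsto_rpow_neg_atTop (sub_pos.2 h)).comp (tendsto_natCast_atTop_atTop (R := ℝ))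
  refine (Asymptotics.isLittleO_iff_tendsto' ?_).2 (h1.congr' ?_)
  · filter_upwards [eventually_ge_atTop 1] with n hn h
    have hn' : (0 : ℝ) < n := by exact_mod_cast hn
    exact absurd h (Real.rpow_pos_of_pos hn' t).ne'
  · filter_upwards [eventually_ge_atTop 1] with n hn
    have hn' : (0 : ℝ) < n := by exact_mod_cast hn
    rw [Function.comp_apply, neg_sub, Real.rpow_sub hn']

/-! ### The three regimes of the recursion for the average rank -/

section Recursion

variable {p g c : ℝ} {a l : ℕ → ℝ}

theorem tendsto_drift (hl : Tendsto (fun n : ℕ => l n / (n : ℝ) ^ p) atTop (𝓝 c)) (hg : g < p)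
    (hD : (fun n : ℕ => (n + 1 : ℝ) * a (n + 1) - (n + 1 + (1 - p)) * a n - p ^ 2 / 2 * l n)
      =O[atTop] fun n : ℕ => (n : ℝ) ^ g) :
    Tendsto (fun n : ℕ => ((n + 1 : ℝ) * a (n + 1) - (n + 1 + (1 - p)) * a n) / (n : ℝ) ^ p)
      atTop (𝓝 (p ^ 2 / 2 * c)) := by
  have h1 := (hD.trans_isLittleO (isLittleO_rpow_natCast hg)).tendsto_div_nhds_zero
  have h2 := h1.add (hl.const_mul (p ^ 2 / 2))
  rw [zero_add] at h2
  refine h2.congr fun n => ?_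
  ring

/-- The increments of a_n / `rising (1 - p) n` and those of `rising (2 * p - 1)` both have order
n^(2p-2), which calls for Stolz-Cesàro. The Gamma factors cancel when returning to n^p = n^(1-p)
n^(2p-1). -/
theorem tendsto_of_half_lt (hp : 1 / 2 < p) (hp1 : p ≤ 1)
    (hl : Tendsto (fun n : ℕ => l n / (n : ℝ) ^ p) atTop (𝓝 c)) (hg : g < p)
    (hD : (fun n : ℕ => (n + 1 : ℝ) * a (n + 1) - (n + 1 + (1 - p)) * a n - p ^ 2 / 2 * l n)
      =O[atTop] fun n : ℕ => (n : ℝ) ^ g) :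
    Tendsto (fun n : ℕ => a n / (n : ℝ) ^ p) atTop (𝓝 (p ^ 2 / (2 * (2 * p - 1)) * c)) := by
  have hq : 0 < 2 * p - 1 := by linarith
  have hr : 0 ≤ 1 - p := by linarith
  have h1 := tendsto_drift hl hg hD
  have hGq := (Gamma_inv_pos hq.le).ne'
  have hGr := (Gamma_inv_pos hr).ne'
  set Gq := (Real.Gamma (2 * p - 1 + 1))⁻¹
  set Gr := (Real.Gamma (1 - p + 1))⁻¹
  have h2 := (h1.div (tendsto_rising_succ hr) hGr).div ((tendsto_rising hq.le).const_mul (2 * p - 1))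
    (mul_ne_zero hq.ne' hGq)
  have hw : ∀ n, rising (2 * p - 1) (n + 1) - rising (2 * p - 1) n
      = rising (2 * p - 1) n * ((2 * p - 1) / (n + 1)) := fun n => by
    rw [rising_succ]
    ring
  have h3 : Tendsto (fun n => a n / rising (1 - p) n / rising (2 * p - 1) n) atTop
      (𝓝 (p ^ 2 / 2 * c / Gr / ((2 * p - 1) * Gq))) := by
    refine tendsto_div_of_tendsto_sub_div (fun n => ?_) (tendsto_rising_atTop hq) (h2.congr' ?_)
    · rw [hw]
      have := rising_pos hq.le n
      positivity
    · filter_upwards [eventually_ge_atTop 1] with n hn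
      have hn' : (0 : ℝ) < n := by exact_mod_cast hn
      have e1 : (n : ℝ) ^ p = (n : ℝ) ^ (1 - p) * (n : ℝ) ^ (2 * p - 1) := by
        rw [← Real.rpow_add hn']
        congr 1
        ring
      have i1 := Real.rpow_pos_of_pos hn' (1 - p)
      have i2 := Real.rpow_pos_of_pos hn' (2 * p - 1)
      have i3 := rising_pos hr (n + 1)
      have i4 := rising_pos hq.le n
      rw [hw, div_rising_succ_sub hr]
      simp only [Pi.div_apply]
      rw [e1]
      field_simp
  have h4 := (h3.mul (tendsto_rising hr)).mul (tendsto_rising hq.le)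
  have e : p ^ 2 / 2 * c / Gr / ((2 * p - 1) * Gq) * Gr * Gq = p ^ 2 / (2 * (2 * p - 1)) * c := by
    field_simp
  rw [e] at h4
  refine h4.congr' ?_
  filter_upwards [eventually_ge_atTop 1] with n hn
  have hn' : (0 : ℝ) < n := by exact_mod_cast hn
  have e1 : (n : ℝ) ^ p = (n : ℝ) ^ (1 - p) * (n : ℝ) ^ (2 * p - 1) := by
    rw [← Real.rpow_add hn']
    congr 1
    ring
  have i1 := Real.rpow_pos_of_pos hn' (1 - p)
  have i2 := Real.rpow_pos_of_pos hn' (2 * p - 1)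
  have i3 := rising_pos hr n
  have i4 := rising_pos hq.le n
  rw [e1]
  generalize rising (2 * p - 1) n = R at *
  field_simp

/-- Here the increments are asymptotic to a constant times 1/(n+1), so the comparison sequence is
the harmonic one; the 1/8 is p²/2. -/
theorem tendsto_of_eq_half (hp : p = 1 / 2)
    (hl : Tendsto (fun n : ℕ => l n / (n : ℝ) ^ p) atTop (𝓝 c)) (hg : g < p)
    (hD : (fun n : ℕ => (n + 1 : ℝ) * a (n + 1) - (n + 1 + (1 - p)) * a n - p ^ 2 / 2 * l n)
      =O[atTop] fun n : ℕ => (n : ℝ) ^ g) :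
    Tendsto (fun n : ℕ => a n / ((n : ℝ) ^ (1 / 2 : ℝ) * Real.log n)) atTop (𝓝 (c / 8)) := by
  have hr : 0 ≤ 1 - p := by linarith
  have hrp : 1 - p = p := by linarith
  have h1 := tendsto_drift hl hg hD
  have hGr := (Gamma_inv_pos hr).ne'
  set Gr := (Real.Gamma (1 - p + 1))⁻¹
  have h2 := h1.div (tendsto_rising_succ hr) hGr
  have hw : ∀ n : ℕ, (harmonic (n + 1) : ℝ) - harmonic n = ((n : ℝ) + 1)⁻¹ := fun n => by
    rw [harmonic_succ]
    push_cast
    ring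
  have h3 : Tendsto (fun n => a n / rising (1 - p) n / (harmonic n : ℝ)) atTop
      (𝓝 (p ^ 2 / 2 * c / Gr)) := by
    refine tendsto_div_of_tendsto_sub_div (fun n => ?_) tendsto_harmonic_atTop (h2.congr' ?_)
    · rw [hw]
      positivity
    · filter_upwards [eventually_ge_atTop 1] with n hn
      have hn' : (0 : ℝ) < n := by exact_mod_cast hn
      have i1 := Real.rpow_pos_of_pos hn' p
      have i3 := rising_pos hr (n + 1)
      rw [hw, div_rising_succ_sub hr]
      simp only [Pi.div_apply]
      rw [show (n : ℝ) ^ (1 - p) = (n : ℝ) ^ p by rw [hrp]]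
      field_simp
  have h4 := (h3.mul (tendsto_rising hr)).mul tendsto_harmonic_div_log
  have e : p ^ 2 / 2 * c / Gr * Gr * 1 = c / 8 := by
    rw [div_mul_cancel₀ _ hGr, hp]
    ring
  rw [e] at h4
  refine h4.congr' ?_
  filter_upwards [eventually_ge_atTop 2] with n hn
  have hn' : (1 : ℝ) < n := by exact_mod_cast hn
  have i1 := Real.rpow_pos_of_pos (zero_lt_one.trans hn') (1 / 2)
  have i2 := Real.log_pos hn'
  have i3 := rising_pos hr n
  have i4 : (0 : ℝ) < harmonic n := by exact_mod_cast harmonic_pos (by omega)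
  rw [show (n : ℝ) ^ (1 - p) = (n : ℝ) ^ (1 / 2 : ℝ) by rw [hrp, hp]]
  field_simp

/-- For p < 1 - p the term in l is itself a summable perturbation, so a limit exists; its positivity
is a separate matter, settled by `rankMean_avgElem_lower`. -/
theorem exists_tendsto_of_lt_half (hp : p < 1 / 2)
    (hl : Tendsto (fun n : ℕ => l n / (n : ℝ) ^ p) atTop (𝓝 c)) (hg : g < 1 - p)
    (hD : (fun n : ℕ => (n + 1 : ℝ) * a (n + 1) - (n + 1 + (1 - p)) * a n - p ^ 2 / 2 * l n)
      =O[atTop] fun n : ℕ => (n : ℝ) ^ g) :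
    ∃ b, Tendsto (fun n => a n / rising (1 - p) n) atTop (𝓝 b) := by
  have hl' : l =O[atTop] fun n : ℕ => (n : ℝ) ^ p := by
    refine Asymptotics.isBigO_of_div_tendsto_nhds ?_ _ hl
    filter_upwards [eventually_ge_atTop 1] with n hn h
    have hn' : (0 : ℝ) < n := by exact_mod_cast hn
    exact absurd h (Real.rpow_pos_of_pos hn' p).ne'
  have hmono : ∀ {s : ℝ}, s ≤ max g p → (fun n : ℕ => (n : ℝ) ^ s)
      =O[atTop] fun n : ℕ => (n : ℝ) ^ (max g p) := by
    intro s hs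
    rcases hs.lt_or_eq with h | h
    · exact (isLittleO_rpow_natCast h).isBigO
    · rw [h]
  refine exists_tendsto_div_rising (s := max g p) (by linarith) (max_lt hg (by linarith)) ?_
  refine ((hD.trans (hmono (le_max_left _ _))).add
    ((hl'.const_mul_left (p ^ 2 / 2)).trans (hmono (le_max_right _ _)))).congr_left fun n => ?_
  ring

end Recursion

/-! ### Limits for the mean number retained and the mean average rank -/

variable {p : ℝ}

theorem tendsto_div_rpow_of_div_rising {a l : ℝ} (ha : 0 ≤ a) {u : ℕ → ℝ}
    (h : Tendsto (fun n => u n / rising a n) atTop (𝓝 l)) :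
    Tendsto (fun n : ℕ => u n / (n : ℝ) ^ a) atTop (𝓝 (l * (Real.Gamma (a + 1))⁻¹)) := by
  refine (h.mul (tendsto_rising ha)).congr fun n => ?_
  rw [div_mul_div_cancel₀ (rising_pos ha n).ne']

theorem exists_tendsto_rankMean_card (hp : 0 < p) (hp1 : p ≤ 1) :
    ∃ c : ℝ, 0 < c ∧
      Tendsto (fun n : ℕ => rankMean p n (fun T => (T.card : ℝ)) / (n : ℝ) ^ p) atTop (𝓝 c) := by
  obtain ⟨l, hl⟩ := exists_tendsto_div_rising hp.le hp
    (u := fun n => rankMean p n (fun T => (T.card : ℝ))) (by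
      refine Asymptotics.IsBigO.of_bound 1 ?_
      filter_upwards [eventually_ge_atTop 1] with n hn
      have h := rankMean_card_succ hp hp1 hn
      rw [Real.rpow_zero, norm_one, mul_one, Real.norm_of_nonneg (by linarith)]
      linarith)
  have hpos : 0 < rankMean p 1 (fun T => (T.card : ℝ)) / rising p 1 := by
    rw [rankMean_one hp]
    have := rising_pos hp.le 1
    simp [this]
  -- The normalized means are nondecreasing from n = 1 on, so the limit is at least the first,
  -- positive, value.
  have hl0 : 0 < l := by
    refine hpos.trans_le (ge_of_tendsto hl ?_)
    filter_upwards [eventually_ge_atTop 1] with n hn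
    exact rising_le_of_le_succ hp.le (fun n hn => (rankMean_card_succ hp hp1 hn).1) hn
  exact ⟨_, mul_pos hl0 (Gamma_inv_pos hp.le), tendsto_div_rpow_of_div_rising hp.le hl⟩

theorem rankMean_avgElem_lower (hp : 0 < p) (hp1 : p ≤ 1) :
    ∃ ε : ℝ, 0 < ε ∧ ∀ n : ℕ, 1 ≤ n → ε ≤ rankMean p n avgElem / rising (1 - p) n := by
  have hr : 0 ≤ 1 - p := by linarith
  refine ⟨rankMean p 1 (shiftedAvg p) / rising (1 - p) 1,
    div_pos (rankMean_one_shiftedAvg_pos hp) (rising_pos hr 1), fun n hn => ?_⟩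
  refine (rising_le_of_le_succ hr (fun n hn => rankMean_shiftedAvg_succ hp hp1 hn) hn).trans ?_
  have := rising_pos hr n
  gcongr
  exact rankMean_shiftedAvg_le hp hn

/-- The exponent lies strictly below max(p, 1-p) for every p. The 1/3 only keeps it positive, as
`isBigO_of_succ_le` requires, since 1 - 4p/3 may be negative. -/
theorem rankMean_avgElem_drift (hp : 0 < p) (hp1 : p ≤ 1) :
    (fun n : ℕ => (n + 1 : ℝ) * rankMean p (n + 1) avgElem
        - (n + 1 + (1 - p)) * rankMean p n avgElem
        - p ^ 2 / 2 * rankMean p n (fun T => (T.card : ℝ)))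
      =O[atTop] fun n : ℕ => (n : ℝ) ^ max (1 - 4 * p / 3) (1 / 3) := by
  have hg : 0 < max (1 - 4 * p / 3) (1 / 3) := lt_max_of_lt_right (by norm_num)
  have h1 : (fun n => rankMean p n scaledSum)
      =O[atTop] fun n : ℕ => (n : ℝ) ^ max (1 - 4 * p / 3) (1 / 3) := by
    refine isBigO_of_succ_le hg (b := 2) (by norm_num)
      (fun n hn => rankMean_scaledSum_nonneg hp hn) fun n hn => ?_
    have h := rankMean_scaledSum_succ hp hp1 hn
    have h0 := rankMean_scaledSum_nonneg hp hn
    have := mul_le_mul_of_nonneg_right (le_max_left (1 - 4 * p / 3) (1 / 3)) h0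
    linarith
  -- The 4 is the 3 of `rankMean_avgElem_succ` plus the 1 of `rankMean_error_le`.
  have h2 : (fun _ : ℕ => (4 : ℝ))
      =O[atTop] fun n : ℕ => (n : ℝ) ^ max (1 - 4 * p / 3) (1 / 3) := by
    have h := (isLittleO_rpow_natCast hg).isBigO.const_mul_left 4
    simpa using h
  refine Asymptotics.IsBigO.trans ?_ (h1.add h2)
  refine Asymptotics.IsBigO.of_bound 1 ?_
  filter_upwards [eventually_ge_atTop 1] with n hn
  have h3 := rankMean_avgElem_succ hp hp1 hn
  have h4 := rankMean_error_le hp hp1 hn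
  have h5 := rankMean_scaledSum_nonneg hp hn
  rw [one_mul, Real.norm_eq_abs, Real.norm_of_nonneg (by linarith)]
  refine le_trans (le_of_eq ?_) (h3.trans (by linarith))
  congr 1
  ring

theorem exists_tendsto_rankMean_avgElem (hp : 0 < p) (hp1 : p ≤ 1) {c : ℝ} (hc : 0 < c)
    (hl : Tendsto (fun n : ℕ => rankMean p n (fun T => (T.card : ℝ)) / (n : ℝ) ^ p)
      atTop (𝓝 c)) :
    ∃ b : ℝ, 0 < b ∧ (p = 1 / 2 → b = c / 8) ∧
      (1 / 2 < p → b = p ^ 2 / (2 * (2 * p - 1)) * c) ∧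
      Tendsto (fun n : ℕ => rankMean p n avgElem / normalizer p n) atTop (𝓝 b) := by
  have hD := rankMean_avgElem_drift hp hp1
  have hr : 0 ≤ 1 - p := by linarith
  rcases lt_trichotomy p (1 / 2) with h | h | h
  · obtain ⟨l, h1⟩ := exists_tendsto_of_lt_half
      (g := max (1 - 4 * p / 3) (1 / 3)) (a := fun n => rankMean p n avgElem) h hl
      (max_lt (by linarith) (by linarith)) hD
    obtain ⟨ε, hε, h2⟩ := rankMean_avgElem_lower hp hp1
    have hl0 : 0 < l := by
      refine hε.trans_le (ge_of_tendsto h1 ?_)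
      filter_upwards [eventually_ge_atTop 1] with n hn using h2 n hn
    refine ⟨_, mul_pos hl0 (Gamma_inv_pos hr), fun h' => absurd h' h.ne,
      fun h' => absurd h h'.not_gt, ?_⟩
    simpa only [normalizer, if_pos h] using tendsto_div_rpow_of_div_rising hr h1
  · refine ⟨c / 8, by positivity, fun _ => rfl, fun h' => absurd h h'.ne', ?_⟩
    have := tendsto_of_eq_half (g := max (1 - 4 * p / 3) (1 / 3))
      (a := fun n => rankMean p n avgElem) h hl (max_lt (by linarith) (by linarith)) hD
    simpa only [normalizer, if_neg h.not_lt, if_pos h] using this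
  · have hq : 0 < 2 * p - 1 := by linarith
    refine ⟨_, by positivity, fun h' => absurd h' h.ne', fun _ => rfl, ?_⟩
    have := tendsto_of_half_lt (g := max (1 - 4 * p / 3) (1 / 3))
      (a := fun n => rankMean p n avgElem) h hp1 hl (max_lt (by linarith) (by linarith)) hD
    simpa only [normalizer, if_neg h.not_gt, if_neg h.ne'] using this

end RankSelection

theorem theorem5p1 (p : ℝ) (hp0 : 0 < p) (hp1 : p ≤ 1) :
    ∃ b c : ℝ, 0 < b ∧ 0 < c ∧
      (p = 1 / 2 → b = c / 8) ∧
      (1 / 2 < p → b = p ^ 2 / (2 * (2 * p - 1)) * c) ∧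
      ∀ (Ω : Type*) [MeasurableSpace Ω] (μ : Measure Ω) [IsProbabilityMeasure μ]
        (X : ℕ → Ω → ℝ), (∀ k, Measurable (X k)) →
        RankSelection.OrderingsEquallyLikely μ X →
        (∀ n, Integrable (fun ω => (RankSelection.numRetained p (fun k => X k ω) n : ℝ)) μ) ∧
        (∀ n, Integrable (fun ω => RankSelection.avgRank p (fun k => X k ω) n) μ) ∧
        Tendsto (fun n : ℕ =>
            (∫ ω, (RankSelection.numRetained p (fun k => X k ω) n : ℝ) ∂μ) / (n : ℝ) ^ p)
          atTop (𝓝 c) ∧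
        Tendsto (fun n : ℕ =>
            (∫ ω, RankSelection.avgRank p (fun k => X k ω) n ∂μ) / RankSelection.normalizer p n)
          atTop (𝓝 b) := by
  obtain ⟨c, hc, hl⟩ := RankSelection.exists_tendsto_rankMean_card hp0 hp1
  obtain ⟨b, hb, hb1, hb2, ha⟩ := RankSelection.exists_tendsto_rankMean_avgElem hp0 hp1 hc hl
  refine ⟨b, c, hb, hc, hb1, hb2, fun Ω _ μ _ X hX hμ => ?_⟩
  refine ⟨fun n => (RankSelection.integral_numRetained hX hμ p n).1,
    fun n => (RankSelection.integral_avgRank hX hμ p n).1, ?_, ?_⟩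
  · simpa only [(RankSelection.integral_numRetained hX hμ p _).2] using hl
  · simpa only [(RankSelection.integral_avgRank hX hμ p _).2] using ha
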